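/- Let $\mathcal{E}\in(0,1)$, put $k=\sqrt{(1-\mathcal{E})/(1+\mathcal{E})}$, and let $$u_0(x)=\sqrt{1-\mathcal{E}}\;\mathrm{sn}\Bigl(x\sqrt{\tfrac{1+\mathcal{E}}{2}},\,k\Bigr),\qquad x\in\mathbb{R},$$ where $\mathrm{sn}(\cdot,k)$ is the Jacobi elliptic sine of modulus $k$; it is a real periodic solution of $u_0''+(1-u_0^2)u_0=0$. For $c\in\mathbb{R}$ let $\Lambda_c=S-cE$, where $S=R-\tfrac12(3-\mathcal{E}^2)Q$ and, for complex-valued $\psi$, $$E(\psi)=\int\Bigl[|\psi_x|^2+\tfrac12(1-|\psi|^2)^2\Bigr]dx,\qquad Q(\psi)=\int|\psi|^2\,dx,$$ $$R(\psi)=\int\Bigl[|\psi_{xx}|^2+3|\psi|^2|\psi_x|^2+\tfrac12(\bar\psi\psi_x+\psi\bar\psi_x)^2+\tfrac12|\psi|^6\Bigr]dx .$$ The second variation $\Lambda_c''(u_0)$ is the real quadratic form obtained by integrating over $\mathbb{R}$ the second derivative at $\epsilon=0$ of the density of $\Lambda_c$ at $u_0+\epsilon\varphi$, for perturbations $\varphi\in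 H^2(\mathbb{R};\mathbb{C})$. It is called positive except for two neutral directions due to symmetries if it is nonnegative on $H^2(\mathbb{R};\mathbb{C})$ and if every bounded function $\varphi:\mathbb{R}\to\mathbb{C}$ of class $C^4$ with $\Lambda_c''(u_0)\varphi=0$ (that is, the associated symmetric bilinear form of $\varphi$ with each smooth compactly supported complex-valued function vanishes) is a real linear combination of $u_0'$ (translations) and $i u_0$ (phase rotations). Then, for all $\mathcal{E}\in(0,1)$ and all $c\ge 1$, the second variation $\Lambda_c''(u_0)$ is positive except for two neutral directions due to symmetries only if $$c\in[c_-,c_+],\qquad c_\pm=2\pm\frac{2k}{1+k^2}.$$ -/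

import Mathlib

open MeasureTheory
open scoped ContDiff

noncomputable section

namespace NLSWave

/-! ### Jacobi's elliptic sine and the periodic wave profile -/

/-- The incomplete elliptic integral of the first kind
`F(φ, k) = ∫₀^φ dθ / √(1 - k² sin² θ)`; for `0 ≤ k < 1` it is an increasing bijection of `ℝ`
in the variable `φ`. -/
def ellipticF (k φ : ℝ) : ℝ :=
  ∫ θ in (0 : ℝ)..φ, 1 / √(1 - k ^ 2 * Real.sin θ ^ 2)

/-- The Jacobi amplitude `am(ξ, k)`, the inverse function of `φ ↦ F(φ, k)`. -/
def jacobiAm (ξ k : ℝ) : ℝ :=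
  Function.invFun (ellipticF k) ξ

/-- The Jacobi elliptic function `sn(ξ, k) = sin (am(ξ, k))`. -/
def jacobiSn (ξ k : ℝ) : ℝ :=
  Real.sin (jacobiAm ξ k)

/-- The elliptic modulus `k = √((1 - ℰ) / (1 + ℰ))`. -/
def modulus (ℰ : ℝ) : ℝ :=
  √((1 - ℰ) / (1 + ℰ))

/-- The profile `u₀(x) = √(1 - ℰ) sn(x √((1 + ℰ) / 2), k)`. -/
def profile (ℰ x : ℝ) : ℝ :=
  √(1 - ℰ) * jacobiSn (x * √((1 + ℰ) / 2)) (modulus ℰ)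

/-! ### The densities of the conserved quantities

The arguments `a, b, d` stand for the values `ψ(x), ψ'(x), ψ''(x)`. -/

/-- `|ψ_x|² + (1/2) (1 - |ψ|²)²`, the density of the energy `E`. -/
def energyDensity (a b : ℂ) : ℝ :=
  ‖b‖ ^ 2 + (1 / 2) * (1 - ‖a‖ ^ 2) ^ 2

/-- `|ψ|²`, the density of the charge `Q`. -/
def chargeDensity (a : ℂ) : ℝ :=
  ‖a‖ ^ 2

/-- `|ψ_xx|² + 3 |ψ|² |ψ_x|² + (1/2) (ψ̄ ψ_x + ψ ψ̄_x)² + (1/2) |ψ|⁶`, the density of the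
higher-order functional `R`. The quantity `ψ̄ ψ_x + ψ ψ̄_x` is real, and the real part only
turns it into a real number. -/
def higherDensity (a b d : ℂ) : ℝ :=
  ‖d‖ ^ 2 + 3 * ‖a‖ ^ 2 * ‖b‖ ^ 2
    + (1 / 2) * ((starRingEnd ℂ a * b + a * starRingEnd ℂ b).re) ^ 2
    + (1 / 2) * ‖a‖ ^ 6

/-- The density of `Λ_c = S - c E`, where `S = R - (1/2) (3 - ℰ²) Q`. -/
def lambdaDensity (ℰ c : ℝ) (a b d : ℂ) : ℝ :=
  higherDensity a b d - (1 / 2) * (3 - ℰ ^ 2) * chargeDensity a - c * energyDensity a b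

/-! ### The second variation at the profile -/

/-- The integrand at `x` of the second variation of `Λ_c` at `u₀`, as a symmetric bilinear
form: the mixed derivative at `s = t = 0` of the density of `Λ_c` at `u₀ + s φ + t η`, where
`(a, b, d)` and `(a', b', d')` are the values at `x` of `φ, φ', φ''` and `η, η', η''`. -/
def secondVariationDensity (ℰ c x : ℝ) (a b d a' b' d' : ℂ) : ℝ :=
  deriv (fun s : ℝ => deriv (fun t : ℝ =>
    lambdaDensity ℰ c
      ((profile ℰ x : ℂ) + s * a + t * a')
      (((deriv (profile ℰ) x : ℝ) : ℂ) + s * b + t * b')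
      (((deriv (deriv (profile ℰ)) x : ℝ) : ℂ) + s * d + t * d')) 0) 0

/-- `⟨Λ_c''(u₀) φ, η⟩` on the whole line, for perturbations `φ, η` whose first and second
derivatives are `φ₁, φ₂` and `η₁, η₂`. -/
def secondVariation (ℰ c : ℝ) (φ φ₁ φ₂ η η₁ η₂ : ℝ → ℂ) : ℝ :=
  ∫ x, secondVariationDensity ℰ c x (φ x) (φ₁ x) (φ₂ x) (η x) (η₁ x) (η₂ x)

/-- `g` is a weak derivative of `f` on `ℝ`. -/
def HasWeakDeriv (f g : ℝ → ℂ) : Prop :=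
  ∀ η : ℝ → ℝ, ContDiff ℝ ∞ η → HasCompactSupport η →
    ∫ x, deriv η x • f x = - ∫ x, η x • g x

/-- `φ` belongs to the Sobolev space `H²(ℝ)` of complex-valued functions, with weak
derivatives `φ₁` and `φ₂` of order one and two. -/
structure MemH2 (φ φ₁ φ₂ : ℝ → ℂ) : Prop where
  memLp : MemLp φ 2 volume
  memLp₁ : MemLp φ₁ 2 volume
  memLp₂ : MemLp φ₂ 2 volume
  weakDeriv₁ : HasWeakDeriv φ φ₁
  weakDeriv₂ : HasWeakDeriv φ₁ φ₂

/-- `φ` is a neutral direction of `Λ_c''(u₀)`: a bounded solution of `Λ_c''(u₀) φ = 0`, the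
equation being understood by pairing with test functions. (Bounded solutions in a larger local
Sobolev class satisfy a fourth-order equation with smooth coefficients and are therefore smooth.) -/
structure IsNeutral (ℰ c : ℝ) (φ : ℝ → ℂ) : Prop where
  contDiff : ContDiff ℝ 4 φ
  bounded : ∃ C : ℝ, ∀ x, ‖φ x‖ ≤ C
  eq_zero : ∀ η : ℝ → ℂ, ContDiff ℝ ∞ η → HasCompactSupport η →
    secondVariation ℰ c φ (deriv φ) (deriv (deriv φ)) η (deriv η) (deriv (deriv η)) = 0

/-- The second variation `Λ_c''(u₀)` is positive except for the two neutral directions due to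
symmetries: it is nonnegative on `H²(ℝ)`, and its only neutral directions are the real linear
combinations of `u₀'` (translations) and `i u₀` (phase rotations). -/
structure IsPositiveExceptSymmetries (ℰ c : ℝ) : Prop where
  nonneg : ∀ φ φ₁ φ₂ : ℝ → ℂ, MemH2 φ φ₁ φ₂ →
    0 ≤ secondVariation ℰ c φ φ₁ φ₂ φ φ₁ φ₂
  neutral : ∀ φ : ℝ → ℂ, IsNeutral ℰ c φ →
    ∃ α β : ℝ, ∀ x,
      φ x = α * ((deriv (profile ℰ) x : ℝ) : ℂ) + β * (Complex.I * (profile ℰ x : ℂ))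

/-- `c₋ = 2 - 2k / (1 + k²)`. -/
def cMinus (ℰ : ℝ) : ℝ :=
  2 - 2 * modulus ℰ / (1 + modulus ℰ ^ 2)

/-- `c₊ = 2 + 2k / (1 + k²)`. -/
def cPlus (ℰ : ℝ) : ℝ :=
  2 + 2 * modulus ℰ / (1 + modulus ℰ ^ 2)

end NLSWave

end

namespace NLSWave

/-! ### The profile as a solution of its differential equation -/

/-! Phase invariance makes i u₀ a neutral direction, so positivity is tested on slow modulations of
it. Since u₀ is real, the form on directions iv with v real is twice the integral of
`imaginaryDensity`.

Let f be a smooth cut-off, a² = 1 - ℰ², θ' = a (u₀² + a), and take v = f(εθ) u₀ - 2εa f'(εθ) u₀'. By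
u₀'' = u₀³ - u₀ and its first integral, the density of v is exactly an x-derivative, plus 2a³(2 + a
- c) ε f'(εθ)² (εθ'), plus ε³ times a bounded remainder (`hasDerivAt_trialFlux`). If θ' ≥ δ > 0,
then v lives on an interval of length O(1/ε): the flux integrates to zero, the substitution y = εθ
turns the leading term into 2a³(2 + a - c) ε ∫ f'², and the remainder contributes O(ε²). Dividing by
ε and letting ε → 0, nonnegativity forces a³(2 + a - c) ≥ 0 (`slope_nonneg`).

Both signs of a are admissible. With s = √(1 - ℰ²) = 2k/(1 + k²), a = s gives c ≤ 2 + s and a = -s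
gives c ≥ 2 - s. -/

theorem one_sub_modulus_sin_pos {k : ℝ} (hk : k ^ 2 < 1) (θ : ℝ) :
    0 < 1 - k ^ 2 * Real.sin θ ^ 2 := by
  nlinarith [Real.sin_sq_le_one θ, sq_nonneg (Real.sin θ), sq_nonneg k]

theorem continuous_ellipticF_integrand {k : ℝ} (hk : k ^ 2 < 1) :
    Continuous fun θ : ℝ => 1 / √(1 - k ^ 2 * Real.sin θ ^ 2) := by
  refine Continuous.div continuous_const (by fun_prop) fun θ => ?_
  exact (Real.sqrt_pos.2 (one_sub_modulus_sin_pos hk θ)).ne'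

theorem hasDerivAt_ellipticF {k : ℝ} (hk : k ^ 2 < 1) (φ : ℝ) :
    HasDerivAt (ellipticF k) (1 / √(1 - k ^ 2 * Real.sin φ ^ 2)) φ :=
  (continuous_ellipticF_integrand hk).integral_hasStrictDerivAt 0 φ |>.hasDerivAt

theorem strictMono_ellipticF {k : ℝ} (hk : k ^ 2 < 1) : StrictMono (ellipticF k) := by
  refine strictMono_of_hasDerivAt_pos (fun φ => hasDerivAt_ellipticF hk φ) fun φ => ?_
  exact one_div_pos.2 (Real.sqrt_pos.2 (one_sub_modulus_sin_pos hk φ))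

/-- The integrand of F is at least 1, so F grows at least linearly in both directions; this gives
surjectivity. -/
theorem monotone_ellipticF_sub_id {k : ℝ} (hk : k ^ 2 < 1) :
    Monotone fun φ => ellipticF k φ - φ := by
  refine monotone_of_hasDerivAt_nonneg
    (fun φ => (hasDerivAt_ellipticF hk φ).sub (hasDerivAt_id φ)) fun φ => ?_
  have h0 := Real.sqrt_pos.2 (one_sub_modulus_sin_pos hk φ)
  have h1 : √(1 - k ^ 2 * Real.sin φ ^ 2) ≤ 1 := by
    rw [Real.sqrt_le_iff, one_pow]
    exact ⟨zero_le_one, by nlinarith [mul_nonneg (sq_nonneg k) (sq_nonneg (Real.sin φ))]⟩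
  have := (one_le_div h0).2 h1
  simpa using this

theorem ellipticF_zero (k : ℝ) : ellipticF k 0 = 0 := by simp [ellipticF]

theorem surjective_ellipticF {k : ℝ} (hk : k ^ 2 < 1) : Function.Surjective (ellipticF k) := by
  have hmono := monotone_ellipticF_sub_id hk
  refine Continuous.surjective
    (continuous_iff_continuousAt.2 fun φ => (hasDerivAt_ellipticF hk φ).continuousAt) ?_ ?_
  · refine Filter.tendsto_atTop_mono' _ ?_ Filter.tendsto_id
    filter_upwards [Filter.eventually_ge_atTop 0] with φ hφ
    have := hmono hφ
    simp only [ellipticF_zero] at this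
    simp only [id]
    linarith
  · refine Filter.tendsto_atBot_mono' _ ?_ Filter.tendsto_id
    filter_upwards [Filter.eventually_le_atBot 0] with φ hφ
    have := hmono hφ
    simp only [ellipticF_zero] at this
    simp only [id]
    linarith

theorem ellipticF_jacobiAm {k : ℝ} (hk : k ^ 2 < 1) (ξ : ℝ) :
    ellipticF k (jacobiAm ξ k) = ξ :=
  Function.invFun_eq (surjective_ellipticF hk ξ)

theorem continuous_jacobiAm {k : ℝ} (hk : k ^ 2 < 1) : Continuous fun ξ => jacobiAm ξ k := by
  have hF := strictMono_ellipticF hk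
  refine Monotone.continuous_of_surjective ?_ fun φ => ⟨ellipticF k φ, ?_⟩
  · intro ξ ξ' h
    rw [← hF.le_iff_le, ellipticF_jacobiAm hk, ellipticF_jacobiAm hk]
    exact h
  · exact Function.leftInverse_invFun hF.injective φ

theorem hasDerivAt_jacobiAm {k : ℝ} (hk : k ^ 2 < 1) (ξ : ℝ) :
    HasDerivAt (fun ξ => jacobiAm ξ k) (√(1 - k ^ 2 * jacobiSn ξ k ^ 2)) ξ := by
  have h0 := Real.sqrt_pos.2 (one_sub_modulus_sin_pos hk (jacobiAm ξ k))
  have h := HasDerivAt.of_local_left_inverse (f := ellipticF k) (g := fun ξ => jacobiAm ξ k)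
    (continuous_jacobiAm hk).continuousAt (hasDerivAt_ellipticF hk (jacobiAm ξ k))
    (one_div_pos.2 h0).ne' (Filter.Eventually.of_forall fun ξ => ellipticF_jacobiAm hk ξ)
  simpa [jacobiSn] using h

/-- The derivative `cn · dn` of `sn`. -/
noncomputable def jacobiSnDeriv (ξ k : ℝ) : ℝ :=
  Real.cos (jacobiAm ξ k) * √(1 - k ^ 2 * jacobiSn ξ k ^ 2)

theorem hasDerivAt_jacobiSn {k : ℝ} (hk : k ^ 2 < 1) (ξ : ℝ) :
    HasDerivAt (fun ξ => jacobiSn ξ k) (jacobiSnDeriv ξ k) ξ :=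
  (hasDerivAt_jacobiAm hk ξ).sin

theorem jacobiSnDeriv_sq {k : ℝ} (hk : k ^ 2 < 1) (ξ : ℝ) :
    jacobiSnDeriv ξ k ^ 2 = (1 - jacobiSn ξ k ^ 2) * (1 - k ^ 2 * jacobiSn ξ k ^ 2) := by
  rw [jacobiSnDeriv, jacobiSn, mul_pow, Real.sq_sqrt (one_sub_modulus_sin_pos hk _).le, Real.cos_sq']

theorem hasDerivAt_jacobiSnDeriv {k : ℝ} (hk : k ^ 2 < 1) (ξ : ℝ) :
    HasDerivAt (fun ξ => jacobiSnDeriv ξ k)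
      (2 * k ^ 2 * jacobiSn ξ k ^ 3 - (1 + k ^ 2) * jacobiSn ξ k) ξ := by
  have hpos : 0 < 1 - k ^ 2 * jacobiSn ξ k ^ 2 := one_sub_modulus_sin_pos hk _
  have h1 := (hasDerivAt_jacobiAm hk ξ).cos
  have h2 := ((((hasDerivAt_jacobiSn hk ξ).pow 2).const_mul (k ^ 2)).const_sub 1).sqrt hpos.ne'
  refine (h1.mul h2).congr_deriv ?_
  have hs := Real.sq_sqrt hpos.le
  have hs0 := Real.sqrt_pos.2 hpos
  have hc : Real.cos (jacobiAm ξ k) ^ 2 = 1 - jacobiSn ξ k ^ 2 := Real.cos_sq' _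
  have hd : jacobiSnDeriv ξ k = Real.cos (jacobiAm ξ k) * √(1 - k ^ 2 * jacobiSn ξ k ^ 2) := rfl
  have hsin : Real.sin (jacobiAm ξ k) = jacobiSn ξ k := rfl
  rw [hd, hsin]
  simp only [Pi.pow_apply]
  set r := √(1 - k ^ 2 * jacobiSn ξ k ^ 2)
  set s := jacobiSn ξ k
  set C := Real.cos (jacobiAm ξ k)
  field_simp
  push_cast
  linear_combination (-2 * s) * hs - 2 * k ^ 2 * s * hc

/-! ### The modulus and the rescaled profile -/

theorem modulus_sq {ℰ : ℝ} (hℰ : ℰ ∈ Set.Ioo (0 : ℝ) 1) :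
    modulus ℰ ^ 2 = (1 - ℰ) / (1 + ℰ) :=
  Real.sq_sqrt (div_nonneg (by linarith [hℰ.2]) (by linarith [hℰ.1]))

theorem modulus_sq_lt_one {ℰ : ℝ} (hℰ : ℰ ∈ Set.Ioo (0 : ℝ) 1) : modulus ℰ ^ 2 < 1 := by
  rw [modulus_sq hℰ, div_lt_one (by linarith [hℰ.1])]
  linarith [hℰ.1]

theorem two_mul_modulus_div {ℰ : ℝ} (hℰ : ℰ ∈ Set.Ioo (0 : ℝ) 1) :
    2 * modulus ℰ / (1 + modulus ℰ ^ 2) = √(1 - ℰ ^ 2) := by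
  have h1 : 0 < 1 + ℰ := by linarith [hℰ.1]
  have h : modulus ℰ * (1 + ℰ) = √(1 - ℰ ^ 2) := by
    rw [modulus, ← Real.sqrt_sq h1.le, ← Real.sqrt_mul' _ (sq_nonneg _), Real.sqrt_sq h1.le]
    congr 1
    field_simp
    ring
  rw [modulus_sq hℰ, ← h]
  field_simp
  ring

/-- The derivative of the profile. -/
noncomputable def profileDeriv (ℰ x : ℝ) : ℝ :=
  √(1 - ℰ) * √((1 + ℰ) / 2) * jacobiSnDeriv (x * √((1 + ℰ) / 2)) (modulus ℰ)

theorem hasDerivAt_profile {ℰ : ℝ} (hℰ : ℰ ∈ Set.Ioo (0 : ℝ) 1) (x : ℝ) :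
    HasDerivAt (profile ℰ) (profileDeriv ℰ x) x := by
  have h := HasDerivAt.comp x (hasDerivAt_jacobiSn (modulus_sq_lt_one hℰ) (x * √((1 + ℰ) / 2)))
    ((hasDerivAt_id x).mul_const (√((1 + ℰ) / 2)))
  refine (h.const_mul (√(1 - ℰ))).congr_deriv ?_
  rw [profileDeriv]
  ring

/-- With A² = 1 - ℰ and b² = (1 + ℰ)/2, the scalings satisfy b²(1 + k²) = 1 and 2k²b² = A², which
normalises both coefficients of the equation for sn. -/
theorem hasDerivAt_profileDeriv {ℰ : ℝ} (hℰ : ℰ ∈ Set.Ioo (0 : ℝ) 1) (x : ℝ) :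
    HasDerivAt (profileDeriv ℰ) (profile ℰ x ^ 3 - profile ℰ x) x := by
  have h := HasDerivAt.comp x
    (hasDerivAt_jacobiSnDeriv (modulus_sq_lt_one hℰ) (x * √((1 + ℰ) / 2)))
    ((hasDerivAt_id x).mul_const (√((1 + ℰ) / 2)))
  refine (h.const_mul (√(1 - ℰ) * √((1 + ℰ) / 2))).congr_deriv ?_
  have h1 : 0 < 1 + ℰ := by linarith [hℰ.1]
  have ha : √(1 - ℰ) ^ 2 = 1 - ℰ := Real.sq_sqrt (by linarith [hℰ.2])
  have hb : √((1 + ℰ) / 2) ^ 2 = (1 + ℰ) / 2 := Real.sq_sqrt (by linarith)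
  rw [modulus_sq hℰ, profile]
  set A := √(1 - ℰ)
  set b := √((1 + ℰ) / 2)
  set s := jacobiSn (x * b) (modulus ℰ)
  have e1 : (1 - ℰ) / (1 + ℰ) * b ^ 2 = (1 - ℰ) / 2 := by rw [hb]; field_simp
  linear_combination -A * s ^ 3 * ha + 2 * A * s ^ 3 * e1 - A * s * e1 - A * s * hb

/-- The first integral of u₀'' = u₀³ - u₀. It lets every power of u₀' above the first be eliminated,
so that density identities become polynomial ones. -/
theorem profileDeriv_sq {ℰ : ℝ} (hℰ : ℰ ∈ Set.Ioo (0 : ℝ) 1) (x : ℝ) :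
    profileDeriv ℰ x ^ 2 = (1 - ℰ ^ 2) / 2 - profile ℰ x ^ 2 + profile ℰ x ^ 4 / 2 := by
  have h1 : 0 < 1 + ℰ := by linarith [hℰ.1]
  have ha : √(1 - ℰ) ^ 2 = 1 - ℰ := Real.sq_sqrt (by linarith [hℰ.2])
  have hb : √((1 + ℰ) / 2) ^ 2 = (1 + ℰ) / 2 := Real.sq_sqrt (by linarith)
  rw [profileDeriv, profile, mul_pow, mul_pow, jacobiSnDeriv_sq (modulus_sq_lt_one hℰ),
    modulus_sq hℰ, mul_pow, mul_pow, ha, hb, show √(1 - ℰ) ^ 4 = (√(1 - ℰ) ^ 2) ^ 2 by ring, ha]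
  field_simp
  ring

theorem profile_sq_le {ℰ : ℝ} (hℰ : ℰ ∈ Set.Ioo (0 : ℝ) 1) (x : ℝ) :
    profile ℰ x ^ 2 ≤ 1 - ℰ := by
  rw [profile, mul_pow, Real.sq_sqrt (by linarith [hℰ.2])]
  exact mul_le_of_le_one_right (by linarith [hℰ.2]) (Real.sin_sq_le_one _)

/-! ### The second variation in purely imaginary directions -/

/-- The integrand of `v ↦ ½ ⟨Λ_c''(u₀) iv, iv⟩` for real `v`, where `p, q` are the values of
`u₀, u₀'` and `v, v₁, v₂` those of the perturbation and its derivatives. -/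
noncomputable def imaginaryDensity (ℰ c p q v v₁ v₂ : ℝ) : ℝ :=
  v₂ ^ 2 + 3 * p ^ 2 * v₁ ^ 2 + 3 * q ^ 2 * v ^ 2 + 4 * p * q * v * v₁ + 3 / 2 * p ^ 4 * v ^ 2
    - 1 / 2 * (3 - ℰ ^ 2) * v ^ 2 - c * (v₁ ^ 2 - (1 - p ^ 2) * v ^ 2)

theorem add_I_mul_add_I_mul (p v s t : ℝ) :
    (p : ℂ) + s * (Complex.I * v) + t * (Complex.I * v) = ⟨p, (s + t) * v⟩ := by
  apply Complex.ext <;> simp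
  ring

theorem sq_norm_mk (a b : ℝ) : ‖(⟨a, b⟩ : ℂ)‖ ^ 2 = a ^ 2 + b ^ 2 := by
  rw [Complex.sq_norm, Complex.normSq_mk]
  ring

theorem lambdaDensity_mk (ℰ c p q r y y₁ y₂ : ℝ) :
    lambdaDensity ℰ c ⟨p, y⟩ ⟨q, y₁⟩ ⟨r, y₂⟩ =
      r ^ 2 + y₂ ^ 2 + 3 * (p ^ 2 + y ^ 2) * (q ^ 2 + y₁ ^ 2) + 2 * (p * q + y * y₁) ^ 2
        + 1 / 2 * (p ^ 2 + y ^ 2) ^ 3 - 1 / 2 * (3 - ℰ ^ 2) * (p ^ 2 + y ^ 2)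
        - c * (q ^ 2 + y₁ ^ 2 + 1 / 2 * (1 - (p ^ 2 + y ^ 2)) ^ 2) := by
  have h6 : ‖(⟨p, y⟩ : ℂ)‖ ^ 6 = (p ^ 2 + y ^ 2) ^ 3 := by rw [← sq_norm_mk]; ring
  simp only [lambdaDensity, higherDensity, chargeDensity, energyDensity, sq_norm_mk, h6,
    Complex.add_re, Complex.mul_re, Complex.conj_re, Complex.conj_im]
  ring

/-- Along u₀ + (s + t) iv the density depends on s + t through an even polynomial of degree six,
because u₀ is real; only its quadratic coefficient survives. -/
theorem deriv_deriv_even_sextic (a₀ a₂ a₄ a₆ : ℝ) :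
    deriv (fun s : ℝ => deriv (fun t : ℝ =>
      a₀ + a₂ * (s + t) ^ 2 + a₄ * (s + t) ^ 4 + a₆ * (s + t) ^ 6) 0) 0 = 2 * a₂ := by
  have h1 : ∀ s : ℝ, deriv (fun t : ℝ =>
      a₀ + a₂ * (s + t) ^ 2 + a₄ * (s + t) ^ 4 + a₆ * (s + t) ^ 6) 0
      = 2 * a₂ * s + 4 * a₄ * s ^ 3 + 6 * a₆ * s ^ 5 := by
    intro s
    have hs : HasDerivAt (fun t : ℝ => s + t) 1 0 := (hasDerivAt_id (0 : ℝ)).const_add s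
    refine HasDerivAt.deriv (((((hs.pow 2).const_mul a₂).const_add a₀).add
      ((hs.pow 4).const_mul a₄)).add ((hs.pow 6).const_mul a₆) |>.congr_deriv ?_)
    norm_num
    ring
  simp only [h1]
  have hs := hasDerivAt_id (0 : ℝ)
  refine HasDerivAt.deriv (((hs.const_mul (2 * a₂)).add
      ((hs.pow 3).const_mul (4 * a₄))).add ((hs.pow 5).const_mul (6 * a₆)) |>.congr_deriv ?_)
  norm_num

theorem secondVariationDensity_I_mul (ℰ c x v v₁ v₂ : ℝ) :
    secondVariationDensity ℰ c x (Complex.I * v) (Complex.I * v₁) (Complex.I * v₂)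
      (Complex.I * v) (Complex.I * v₁) (Complex.I * v₂) =
    2 * imaginaryDensity ℰ c (profile ℰ x) (deriv (profile ℰ) x) v v₁ v₂ := by
  simp only [secondVariationDensity, add_I_mul_add_I_mul, lambdaDensity_mk]
  generalize profile ℰ x = p
  generalize deriv (profile ℰ) x = q
  generalize deriv (deriv (profile ℰ)) x = r
  -- The quadratic coefficient is left to unification with `imaginaryDensity`; the others are read
  -- off from `lambdaDensity_mk`.
  rw [← deriv_deriv_even_sextic (r ^ 2 + 3 * p ^ 2 * q ^ 2 + 2 * (p * q) ^ 2 + 1 / 2 * p ^ 6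
      - 1 / 2 * (3 - ℰ ^ 2) * p ^ 2 - c * (q ^ 2 + 1 / 2 * (1 - p ^ 2) ^ 2)) _
      (3 * v ^ 2 * v₁ ^ 2 + 2 * (v * v₁) ^ 2 + 3 / 2 * p ^ 2 * v ^ 4 - c * (1 / 2 * v ^ 4))
      (1 / 2 * v ^ 6)]
  congr 1
  funext s
  congr 1
  funext t
  rw [imaginaryDensity]
  ring

theorem hasWeakDeriv_of_hasDerivAt {f g : ℝ → ℂ} (hf : ∀ x, HasDerivAt f (g x) x)
    (hg : Continuous g) : HasWeakDeriv f g := by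
  intro η hη hηc
  have hfc : Continuous f := continuous_iff_continuousAt.2 fun x => (hf x).continuousAt
  have hη' : Continuous (deriv η) := hη.continuous_deriv (by simp)
  have hη1 : ∀ x, HasDerivAt η (deriv η x) x := fun x =>
    (hη.differentiable (by simp) x).hasDerivAt
  have hcs : HasCompactSupport fun x => η x • f x := hηc.smul_right
  have h1 : Integrable fun x => deriv η x • f x :=
    (hη'.smul hfc).integrable_of_hasCompactSupport hηc.deriv.smul_right
  have h2 : Integrable fun x => η x • g x :=
    (hη.continuous.smul hg).integrable_of_hasCompactSupport hηc.smul_right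
  have h3 : Integrable fun x => η x • f x :=
    (hη.continuous.smul hfc).integrable_of_hasCompactSupport hcs
  have h := integral_eq_zero_of_hasDerivAt_of_integrable
    (fun x => (hη1 x).smul (hf x)) (h2.add h1) h3
  rw [integral_add h2 h1] at h
  exact eq_neg_of_add_eq_zero_right h

theorem memH2_I_mul {v v₁ v₂ : ℝ → ℝ} (h : ∀ x, HasDerivAt v (v₁ x) x)
    (h₁ : ∀ x, HasDerivAt v₁ (v₂ x) x) (h₂ : Continuous v₂) {L : ℝ}
    (hL : ∀ x, L < |x| → v x = 0 ∧ v₁ x = 0 ∧ v₂ x = 0) :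
    MemH2 (fun x => Complex.I * v x) (fun x => Complex.I * v₁ x) (fun x => Complex.I * v₂ x) := by
  have hcv : Continuous v := continuous_iff_continuousAt.2 fun x => (h x).continuousAt
  have hcv₁ : Continuous v₁ := continuous_iff_continuousAt.2 fun x => (h₁ x).continuousAt
  have hsupp : ∀ w : ℝ → ℝ, (∀ x, L < |x| → w x = 0) →
      HasCompactSupport fun x => Complex.I * (w x : ℂ) := by
    intro w hw
    refine HasCompactSupport.intro (isCompact_Icc (a := -L) (b := L)) fun x hx => ?_
    rw [Set.mem_Icc, ← abs_le, not_le] at hx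
    simp [hw x hx]
  have hcont : ∀ w : ℝ → ℝ, Continuous w → Continuous fun x => Complex.I * (w x : ℂ) :=
    fun w hw => continuous_const.mul (Complex.continuous_ofReal.comp hw)
  exact
    { memLp := (hcont v hcv).memLp_of_hasCompactSupport (hsupp v fun x hx => (hL x hx).1)
      memLp₁ := (hcont v₁ hcv₁).memLp_of_hasCompactSupport (hsupp v₁ fun x hx => (hL x hx).2.1)
      memLp₂ := (hcont v₂ h₂).memLp_of_hasCompactSupport (hsupp v₂ fun x hx => (hL x hx).2.2)
      weakDeriv₁ := hasWeakDeriv_of_hasDerivAt (fun x => (h x).ofReal_comp.const_mul _)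
        (hcont v₁ hcv₁)
      weakDeriv₂ := hasWeakDeriv_of_hasDerivAt (fun x => (h₁ x).ofReal_comp.const_mul _)
        (hcont v₂ h₂) }

/-! ### Slowly modulated phase rotations

For a profile with values `p, q` of `u₀, u₀'`, a parameter `a` with `a² = 1 - ℰ²` and a slow phase
`θ` with `θ' = a (p² + a)`, the trial function is `v = f(εθ) u₀ - 2εa f'(εθ) u₀'`. In the formulas
below `f₀, f₁, f₂, f₃` stand for the values of `f` and its derivatives at `εθ`. -/

/-- The value of the trial function. -/
noncomputable def trial (a ε f₀ f₁ p q : ℝ) : ℝ :=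
  f₀ * p - 2 * ε * a * f₁ * q

/-- The derivative of the trial function. -/
noncomputable def trialDeriv (a ε f₀ f₁ f₂ p q : ℝ) : ℝ :=
  f₀ * q + ε * f₁ * (a * p * (2 + a - p ^ 2)) - 2 * ε ^ 2 * a * (a * (p ^ 2 + a)) * f₂ * q

/-- The second derivative of the trial function. -/
noncomputable def trialDerivTwo (a ε f₀ f₁ f₂ f₃ p q : ℝ) : ℝ :=
  f₀ * (p ^ 3 - p) + 2 * ε * a * f₁ * (1 + a - p ^ 2) * q
    + ε ^ 2 * f₂ * (a ^ 2 * p * (4 * a - a ^ 2 + 8 * p ^ 2 - 2 * a * p ^ 2 - 5 * p ^ 4))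
    - 2 * ε ^ 3 * a * (a * (p ^ 2 + a)) ^ 2 * f₃ * q

/-- The flux whose derivative is the second variation density of the trial function up to the
leading term and a remainder of third order in `ε`. -/
noncomputable def trialFlux (a c ε f₀ f₁ f₂ p q : ℝ) : ℝ :=
  f₀ ^ 2 * (q * (-c * p + 3 * p ^ 3 + 0 * p ^ 5))
    + ε * (f₀ * f₁ * (2 * a * (a ^ 2 * c - a ^ 2 - (2 * c + a + 2 * a ^ 2) * p ^ 2
      + (6 + c + a) * p ^ 4 - 3 * p ^ 6)))
    + ε ^ 2 * (2 * a ^ 2 * (f₁ ^ 2 *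
        (q * ((2 * c + 2 * a + 2 * a ^ 2) * p + (-6 - c - 2 * a) * p ^ 3 + 3 * p ^ 5)))
      + 4 * a ^ 2 * (f₀ * f₂ * (q * (a * p + (1 - a) * p ^ 3 + (-1) * p ^ 5))))

/-- The remainder of the second variation density of the trial function, divided by `ε ^ 3`. -/
noncomputable def trialRemainder (a c ε f₁ f₂ f₃ p q : ℝ) : ℝ :=
  f₁ * f₂ * (q * p * a ^ 3 * (16 * a + 4 * a ^ 2 * c - 4 * a ^ 3 + 32 * p ^ 2 - 24 * a * p ^ 2
      + 4 * a * c * p ^ 2 - 4 * a ^ 2 * p ^ 2 - 72 * p ^ 4 + 32 * p ^ 6))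
    + ε * (f₂ ^ 2 * ((a ^ 2 * p * (4 * a - a ^ 2 + 8 * p ^ 2 - 2 * a * p ^ 2 - 5 * p ^ 4)) ^ 2
        + (12 * p ^ 2 - 4 * c) * a ^ 2 * (a * (p ^ 2 + a)) ^ 2 * q ^ 2)
      - 8 * a ^ 2 * f₁ * f₃ * (a * (p ^ 2 + a)) ^ 2 * (1 + a - p ^ 2) * q ^ 2)
    - ε ^ 2 * (4 * a * f₂ * f₃ * (a * (p ^ 2 + a)) ^ 2 * q
      * (a ^ 2 * p * (4 * a - a ^ 2 + 8 * p ^ 2 - 2 * a * p ^ 2 - 5 * p ^ 4)))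
    + ε ^ 3 * (4 * a ^ 2 * f₃ ^ 2 * (a * (p ^ 2 + a)) ^ 4 * q ^ 2)

/-! ### Derivatives of the trial function and the flux identity -/

section Calculus

variable {a ε : ℝ} {p q θ f₀ f₁ f₂ f₃ : ℝ → ℝ}

theorem hasDerivAt_comp_slow {g g' : ℝ → ℝ} {x : ℝ}
    (hθ : HasDerivAt θ (a * (p x ^ 2 + a)) x)
    (hg : ∀ y, HasDerivAt g (g' y) y) :
    HasDerivAt (fun x => g (ε * θ x)) (ε * (a * (p x ^ 2 + a)) * g' (ε * θ x)) x :=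
  ((hg (ε * θ x)).comp x (hθ.const_mul ε)).congr_deriv (by ring)

/-- Three blocks of `trialFlux` have this shape; its padding term `0 * p ^ 5` makes the first one
fit. -/
theorem hasDerivAt_mul_quintic {x : ℝ} (hp : HasDerivAt p (q x) x)
    (hq : HasDerivAt q (p x ^ 3 - p x) x) (k₁ k₃ k₅ : ℝ) :
    HasDerivAt (fun x => q x * (k₁ * p x + k₃ * p x ^ 3 + k₅ * p x ^ 5))
      ((p x ^ 3 - p x) * (k₁ * p x + k₃ * p x ^ 3 + k₅ * p x ^ 5)
        + q x ^ 2 * (k₁ + 3 * k₃ * p x ^ 2 + 5 * k₅ * p x ^ 4)) x := by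
  refine (hq.mul (((hp.const_mul k₁).add ((hp.pow 3).const_mul k₃)).add
    ((hp.pow 5).const_mul k₅))).congr_deriv ?_
  simp only [Pi.add_apply, Pi.pow_apply]
  norm_num
  ring

theorem hasDerivAt_trial {x : ℝ} (hp : HasDerivAt p (q x) x)
    (hq : HasDerivAt q (p x ^ 3 - p x) x) (hθ : HasDerivAt θ (a * (p x ^ 2 + a)) x)
    (h₀ : ∀ y, HasDerivAt f₀ (f₁ y) y) (h₁ : ∀ y, HasDerivAt f₁ (f₂ y) y) :
    HasDerivAt (fun x => trial a ε (f₀ (ε * θ x)) (f₁ (ε * θ x)) (p x) (q x))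
      (trialDeriv a ε (f₀ (ε * θ x)) (f₁ (ε * θ x)) (f₂ (ε * θ x)) (p x) (q x)) x := by
  refine (((hasDerivAt_comp_slow hθ h₀).mul hp).sub
    (((hasDerivAt_comp_slow hθ h₁).const_mul (2 * ε * a)).mul hq)).congr_deriv ?_
  rw [trialDeriv]
  ring

theorem hasDerivAt_trialDeriv {x : ℝ} (hp : HasDerivAt p (q x) x)
    (hq : HasDerivAt q (p x ^ 3 - p x) x) (hθ : HasDerivAt θ (a * (p x ^ 2 + a)) x)
    (hpq : q x ^ 2 = a ^ 2 / 2 - p x ^ 2 + p x ^ 4 / 2)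
    (h₀ : ∀ y, HasDerivAt f₀ (f₁ y) y) (h₁ : ∀ y, HasDerivAt f₁ (f₂ y) y)
    (h₂ : ∀ y, HasDerivAt f₂ (f₃ y) y) :
    HasDerivAt
      (fun x => trialDeriv a ε (f₀ (ε * θ x)) (f₁ (ε * θ x)) (f₂ (ε * θ x)) (p x) (q x))
      (trialDerivTwo a ε (f₀ (ε * θ x)) (f₁ (ε * θ x)) (f₂ (ε * θ x)) (f₃ (ε * θ x))
        (p x) (q x)) x := by
  have hk := (hp.const_mul a).mul ((hp.pow 2).const_sub (2 + a))
  have hτ := (((hp.pow 2).add_const a).const_mul a).const_mul (2 * ε ^ 2 * a)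
  refine ((((hasDerivAt_comp_slow hθ h₀).mul hq).add
    (((hasDerivAt_comp_slow hθ h₁).const_mul ε).mul hk)).sub
    ((hτ.mul (hasDerivAt_comp_slow hθ h₂)).mul hq)).congr_deriv ?_
  simp only [trialDerivTwo, Pi.pow_apply, Pi.mul_apply]
  norm_num
  linear_combination (-4 * ε ^ 2 * a ^ 2 * p x * f₂ (ε * θ x)) * hpq

/-- The heart of the proof. The f₀² terms are exact because i u₀ is neutral, and the choice of θ'
and of the corrector -2εa f₁ q leaves, at order ε², only a multiple of f₁² θ' modulo exact terms.
Only a² is tied to ℰ, so the sign of a stays free. -/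
theorem hasDerivAt_trialFlux {ℰ c x : ℝ} (hp : HasDerivAt p (q x) x)
    (hq : HasDerivAt q (p x ^ 3 - p x) x) (hθ : HasDerivAt θ (a * (p x ^ 2 + a)) x)
    (hpq : q x ^ 2 = a ^ 2 / 2 - p x ^ 2 + p x ^ 4 / 2) (hℰ : ℰ ^ 2 = 1 - a ^ 2)
    (h₀ : ∀ y, HasDerivAt f₀ (f₁ y) y) (h₁ : ∀ y, HasDerivAt f₁ (f₂ y) y)
    (h₂ : ∀ y, HasDerivAt f₂ (f₃ y) y) :
    HasDerivAt
      (fun x => trialFlux a c ε (f₀ (ε * θ x)) (f₁ (ε * θ x)) (f₂ (ε * θ x)) (p x) (q x))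
      (imaginaryDensity ℰ c (p x) (q x)
          (trial a ε (f₀ (ε * θ x)) (f₁ (ε * θ x)) (p x) (q x))
          (trialDeriv a ε (f₀ (ε * θ x)) (f₁ (ε * θ x)) (f₂ (ε * θ x)) (p x) (q x))
          (trialDerivTwo a ε (f₀ (ε * θ x)) (f₁ (ε * θ x)) (f₂ (ε * θ x)) (f₃ (ε * θ x))
            (p x) (q x))
        - ε * (2 * a ^ 3 * (2 + a - c)) * (f₁ (ε * θ x) ^ 2 * (ε * (a * (p x ^ 2 + a))))
        - ε ^ 3 * trialRemainder a c ε (f₁ (ε * θ x)) (f₂ (ε * θ x)) (f₃ (ε * θ x))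
          (p x) (q x)) x := by
  have e₀ := hasDerivAt_comp_slow (ε := ε) hθ h₀
  have e₁ := hasDerivAt_comp_slow (ε := ε) hθ h₁
  have e₂ := hasDerivAt_comp_slow (ε := ε) hθ h₂
  have hk := (((((hp.pow 2).const_mul (2 * c + a + 2 * a ^ 2)).const_sub
    (a ^ 2 * c - a ^ 2)).add ((hp.pow 4).const_mul (6 + c + a))).sub
    ((hp.pow 6).const_mul 3)).const_mul (2 * a)
  refine ((((e₀.pow 2).mul (hasDerivAt_mul_quintic hp hq (-c) 3 0)).add
    (((e₀.mul e₁).mul hk).const_mul ε)).add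
    (((((e₁.pow 2).mul (hasDerivAt_mul_quintic hp hq
        (2 * c + 2 * a + 2 * a ^ 2) (-6 - c - 2 * a) 3)).const_mul (2 * a ^ 2)).add
      (((e₀.mul e₂).mul (hasDerivAt_mul_quintic hp hq a (1 - a) (-1))).const_mul
        (4 * a ^ 2))).const_mul (ε ^ 2))).congr_deriv ?_
  simp only [Pi.pow_apply, Pi.mul_apply, Pi.add_apply, Pi.sub_apply]
  simp only [imaginaryDensity, hℰ, trial, trialDeriv, trialDerivTwo, trialRemainder]
  generalize p x = P at *
  generalize q x = Q at *
  generalize f₀ (ε * θ x) = F₀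
  generalize f₁ (ε * θ x) = F₁
  generalize f₂ (ε * θ x) = F₂
  generalize f₃ (ε * θ x) = F₃
  norm_num
  -- The multiplier collects the coefficients of q² and higher powers of q; its summand Q² + a²/2 -
  -- P² + P⁴/2 comes from factoring a difference of squares in the q⁴ term.
  linear_combination
    (-((2 * ε * a * F₁ * (1 + a - P ^ 2)) ^ 2
      + (3 * P ^ 2 - c) * (F₀ ^ 2 - 4 * ε ^ 2 * a * (a * (P ^ 2 + a)) * F₀ * F₂)
      + 3 * (F₀ ^ 2 * P ^ 2 - 4 * ε * a * F₀ * F₁ * P * Q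
        + 4 * ε ^ 2 * a ^ 2 * F₁ ^ 2 * (Q ^ 2 + a ^ 2 / 2 - P ^ 2 + P ^ 4 / 2))
      + 4 * P * (F₀ * P * (F₀ - 2 * ε ^ 2 * a * (a * (P ^ 2 + a)) * F₂)
        - 2 * ε * a * F₁ * (ε * F₁ * (a * P * (2 + a - P ^ 2)))
        - 2 * ε * a * F₁ * (F₀ - 2 * ε ^ 2 * a * (a * (P ^ 2 + a)) * F₂) * Q)
      + 4 * ε ^ 2 * a ^ 2 * F₁ ^ 2 * (3 / 2 * P ^ 4 - 1 - a ^ 2 / 2 + c * (1 - P ^ 2))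
      - (F₀ ^ 2 * (9 * P ^ 2 - c)
        + ε ^ 2 * (2 * a ^ 2 * (F₁ ^ 2 * (2 * c + 2 * a + 2 * a ^ 2
          + 3 * (-6 - c - 2 * a) * P ^ 2 + 15 * P ^ 4))
          + 4 * a ^ 2 * (F₀ * F₂ * (a + 3 * (1 - a) * P ^ 2 - 5 * P ^ 4)))))) * hpq

end Calculus

/-! ### Necessity of the bounds on `c` -/

/-- A cut-off function with three derivatives, supported in `[-2, 2]`. -/
theorem exists_cutoff : ∃ f₀ f₁ f₂ f₃ : ℝ → ℝ, (∀ y, HasDerivAt f₀ (f₁ y) y) ∧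
    (∀ y, HasDerivAt f₁ (f₂ y) y) ∧ (∀ y, HasDerivAt f₂ (f₃ y) y) ∧ Continuous f₃ ∧
    (∀ y, 2 < |y| → f₀ y = 0 ∧ f₁ y = 0 ∧ f₂ y = 0 ∧ f₃ y = 0) ∧ 0 < ∫ y, f₁ y ^ 2 := by
  let b : ContDiffBump (0 : ℝ) := ⟨1, 2, one_pos, one_lt_two⟩
  have s₀ : ContDiff ℝ ∞ (b : ℝ → ℝ) := b.contDiff
  have s₁ := (contDiff_infty_iff_deriv.1 s₀).2
  have s₂ := (contDiff_infty_iff_deriv.1 s₁).2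
  have s₃ := (contDiff_infty_iff_deriv.1 s₂).2
  have hd : ∀ g : ℝ → ℝ, ContDiff ℝ ∞ g → ∀ y, HasDerivAt g (deriv g y) y :=
    fun g hg y => (hg.differentiable (by simp) y).hasDerivAt
  have z₀ : ∀ y : ℝ, 2 < |y| → y ∉ tsupport (b : ℝ → ℝ) := by
    intro y hy
    rw [b.tsupport_eq, Metric.mem_closedBall, Real.dist_eq, sub_zero]
    exact not_le.2 hy
  have t₁ : tsupport (deriv b) ⊆ tsupport b := tsupport_deriv_subset
  have t₂ : tsupport (deriv (deriv b)) ⊆ tsupport (deriv b) := tsupport_deriv_subset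
  have t₃ : tsupport (deriv (deriv (deriv b))) ⊆ tsupport (deriv (deriv b)) :=
    tsupport_deriv_subset
  refine ⟨b, deriv b, deriv (deriv b), deriv (deriv (deriv b)), hd _ s₀, hd _ s₁, hd _ s₂,
    s₃.continuous, fun y hy => ⟨image_eq_zero_of_notMem_tsupport (z₀ y hy),
      image_eq_zero_of_notMem_tsupport fun h => z₀ y hy (t₁ h),
      image_eq_zero_of_notMem_tsupport fun h => z₀ y hy (t₁ (t₂ h)),
      image_eq_zero_of_notMem_tsupport fun h => z₀ y hy (t₁ (t₂ (t₃ h)))⟩, ?_⟩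
  obtain ⟨y, hy⟩ : ∃ y, deriv b y ≠ 0 := by
    by_contra! h
    have h01 := is_const_of_deriv_eq_zero (s₀.differentiable (by simp)) h 0 3
    rw [b.one_of_mem_closedBall (Metric.mem_closedBall_self zero_le_one)] at h01
    rw [image_eq_zero_of_notMem_tsupport (z₀ 3 (by norm_num))] at h01
    exact one_ne_zero h01
  have hcs : HasCompactSupport (deriv b) := b.hasCompactSupport.deriv
  exact Continuous.integral_pos_of_hasCompactSupport_nonneg_nonzero (x := y)
    (s₁.continuous.pow 2) (hcs.comp_left (g := fun r : ℝ => r ^ 2) (by simp))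
    (fun y => sq_nonneg _) (pow_ne_zero 2 hy)

theorem linear_growth_of_le_deriv {θ τ : ℝ → ℝ} {δ : ℝ} (h0 : θ 0 = 0)
    (hθ : ∀ x, HasDerivAt θ (τ x) x) (hτ : ∀ x, δ ≤ τ x) (x : ℝ) :
    (0 ≤ x → δ * x ≤ θ x) ∧ (x ≤ 0 → θ x ≤ δ * x) := by
  have hmono : Monotone fun x => θ x - δ * x :=
    monotone_of_hasDerivAt_nonneg
      (fun x => (hθ x).sub ((hasDerivAt_id x).const_mul δ)) fun x => by
        simpa using hτ x
  refine ⟨fun hx => ?_, fun hx => ?_⟩ <;>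
  · have := hmono hx
    simp only [h0, mul_zero, sub_zero] at this
    linarith

/-- By compactness: the remainder is continuous in all its arguments and vanishes for y outside [-2,
2]. The bound is uniform in ε. -/
theorem exists_trialRemainder_bound (a c : ℝ) {f₁ f₂ f₃ : ℝ → ℝ} (h₁ : Continuous f₁)
    (h₂ : Continuous f₂) (h₃ : Continuous f₃)
    (hz : ∀ y, 2 < |y| → f₁ y = 0 ∧ f₂ y = 0 ∧ f₃ y = 0) :
    ∃ C : ℝ, ∀ ε y p q : ℝ, ε ∈ Set.Icc (0 : ℝ) 1 → |p| ≤ 1 → |q| ≤ 1 →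
      |trialRemainder a c ε (f₁ y) (f₂ y) (f₃ y) p q| ≤ C := by
  have hcont : Continuous fun z : ℝ × ℝ × ℝ × ℝ =>
      trialRemainder a c z.1 (f₁ z.2.1) (f₂ z.2.1) (f₃ z.2.1) z.2.2.1 z.2.2.2 := by
    unfold trialRemainder
    fun_prop
  obtain ⟨C, hC⟩ := ((isCompact_Icc (a := (0 : ℝ)) (b := 1)).prod
    ((isCompact_Icc (a := (-2 : ℝ)) (b := 2)).prod
      ((isCompact_Icc (a := (-1 : ℝ)) (b := 1)).prod
        (isCompact_Icc (a := (-1 : ℝ)) (b := 1))))).exists_bound_of_continuousOn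
          hcont.continuousOn
  refine ⟨max C 0, fun ε y p q hε hp hq => ?_⟩
  by_cases hy : 2 < |y|
  · obtain ⟨e₁, e₂, e₃⟩ := hz y hy
    rw [e₁, e₂, e₃]
    simp [trialRemainder]
  · exact (hC (ε, y, p, q) ⟨hε, abs_le.1 (not_lt.1 hy), abs_le.1 hp, abs_le.1 hq⟩).trans
      (le_max_left _ _)

theorem slope_nonneg {ℰ c a δ : ℝ} (hℰ : ℰ ∈ Set.Ioo (0 : ℝ) 1) (ha : a ^ 2 = 1 - ℰ ^ 2)
    (hδ : 0 < δ) (hτ : ∀ x, δ ≤ a * (profile ℰ x ^ 2 + a))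
    (hpos : ∀ φ φ₁ φ₂ : ℝ → ℂ, MemH2 φ φ₁ φ₂ → 0 ≤ secondVariation ℰ c φ φ₁ φ₂ φ φ₁ φ₂) :
    0 ≤ a ^ 3 * (2 + a - c) := by
  obtain ⟨f₀, f₁, f₂, f₃, h₀, h₁, h₂, c₃, hz, hJ⟩ := exists_cutoff
  have c₀ : Continuous f₀ := continuous_iff_continuousAt.2 fun x => (h₀ x).continuousAt
  have c₁ : Continuous f₁ := continuous_iff_continuousAt.2 fun x => (h₁ x).continuousAt
  have c₂ : Continuous f₂ := continuous_iff_continuousAt.2 fun x => (h₂ x).continuousAt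
  obtain ⟨C, hC⟩ := exists_trialRemainder_bound a c c₁ c₂ c₃ fun y hy => (hz y hy).2
  set p := profile ℰ
  set q := profileDeriv ℰ
  have hp : ∀ x, HasDerivAt p (q x) x := hasDerivAt_profile hℰ
  have hq : ∀ x, HasDerivAt q (p x ^ 3 - p x) x := hasDerivAt_profileDeriv hℰ
  have hpq : ∀ x, q x ^ 2 = a ^ 2 / 2 - p x ^ 2 + p x ^ 4 / 2 := fun x => by
    rw [ha]; exact profileDeriv_sq hℰ x
  have cp : Continuous p := continuous_iff_continuousAt.2 fun x => (hp x).continuousAt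
  have cq : Continuous q := continuous_iff_continuousAt.2 fun x => (hq x).continuousAt
  have hple : ∀ x, p x ^ 2 ≤ 1 := fun x => (profile_sq_le hℰ x).trans (by linarith [hℰ.1])
  have hp1 : ∀ x, |p x| ≤ 1 := fun x => (sq_le_one_iff_abs_le_one _).1 (hple x)
  have hq1 : ∀ x, |q x| ≤ 1 := fun x => by
    rw [← sq_le_one_iff_abs_le_one, hpq x, ha]
    nlinarith [hple x, sq_nonneg (p x), sq_nonneg ℰ]
  let θ : ℝ → ℝ := fun x => ∫ y in (0 : ℝ)..x, a * (p y ^ 2 + a)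
  have cτ : Continuous fun x => a * (p x ^ 2 + a) := by fun_prop
  have hθ : ∀ x, HasDerivAt θ (a * (p x ^ 2 + a)) x := fun x =>
    (cτ.integral_hasStrictDerivAt 0 x).hasDerivAt
  have cθ : Continuous θ := continuous_iff_continuousAt.2 fun x => (hθ x).continuousAt
  have hθ0 : θ 0 = 0 := by simp [θ]
  have hgrow := linear_growth_of_le_deriv hθ0 hθ hτ
  have key : ∀ ε ∈ Set.Ioc (0 : ℝ) 1,
      0 ≤ 2 * (a ^ 3 * (2 + a - c)) * (∫ y, f₁ y ^ 2) + ε * (C * (6 / δ)) := by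
    intro ε hε
    have hε0 := hε.1
    -- As |θ x| ≥ δ|x|, this makes |εθ| ≥ 3 for |x| ≥ L, strictly beyond the support [-2, 2] of the
    -- cut-off.
    set L : ℝ := 3 / (ε * δ) with hL
    have hLpos : 0 < L := by positivity
    have hLe : ε * (δ * L) = 3 := by rw [hL]; field_simp
    have hright : ∀ x, L ≤ x → 3 ≤ ε * θ x := fun x hx => by
      rw [← hLe]
      exact mul_le_mul_of_nonneg_left
        ((mul_le_mul_of_nonneg_left hx hδ.le).trans ((hgrow x).1 (hLpos.le.trans hx))) hε0.le
    have hleft : ∀ x, x ≤ -L → ε * θ x ≤ -3 := fun x hx => by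
      rw [← hLe, ← mul_neg, ← mul_neg]
      exact mul_le_mul_of_nonneg_left
        (((hgrow x).2 (by linarith)).trans (mul_le_mul_of_nonneg_left hx hδ.le)) hε0.le
    have hfar : ∀ x, L ≤ |x| → 2 < |ε * θ x| := fun x hx => by
      rcases le_abs.1 hx with h | h
      · exact lt_of_lt_of_le (by linarith [hright x h]) (le_abs_self _)
      · exact lt_of_lt_of_le (by linarith [hleft x (by linarith)]) (neg_le_abs _)
    let v : ℝ → ℝ := fun x => trial a ε (f₀ (ε * θ x)) (f₁ (ε * θ x)) (p x) (q x)
    let v₁ : ℝ → ℝ := fun x =>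
      trialDeriv a ε (f₀ (ε * θ x)) (f₁ (ε * θ x)) (f₂ (ε * θ x)) (p x) (q x)
    let v₂ : ℝ → ℝ := fun x =>
      trialDerivTwo a ε (f₀ (ε * θ x)) (f₁ (ε * θ x)) (f₂ (ε * θ x)) (f₃ (ε * θ x)) (p x) (q x)
    have cv : Continuous v := by simp only [v, trial]; fun_prop
    have cv₁ : Continuous v₁ := by simp only [v₁, trialDeriv]; fun_prop
    have cv₂ : Continuous v₂ := by simp only [v₂, trialDerivTwo]; fun_prop
    have hvz : ∀ x, L ≤ |x| → v x = 0 ∧ v₁ x = 0 ∧ v₂ x = 0 := fun x hx => by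
      obtain ⟨e₀, e₁, e₂, e₃⟩ := hz _ (hfar x hx)
      simp [v, v₁, v₂, trial, trialDeriv, trialDerivTwo, e₀, e₁, e₂, e₃]
    let dens : ℝ → ℝ := fun x => imaginaryDensity ℰ c (p x) (q x) (v x) (v₁ x) (v₂ x)
    let lead : ℝ → ℝ := fun x => f₁ (ε * θ x) ^ 2 * (ε * (a * (p x ^ 2 + a)))
    let rem : ℝ → ℝ := fun x => trialRemainder a c ε (f₁ (ε * θ x)) (f₂ (ε * θ x))
      (f₃ (ε * θ x)) (p x) (q x)
    have cdens : Continuous dens := by simp only [dens, imaginaryDensity]; fun_prop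
    have clead : Continuous lead := by simp only [lead]; fun_prop
    have crem : Continuous rem := by simp only [rem, trialRemainder]; fun_prop
    have hdens : 0 ≤ ∫ x in -L..L, dens x := by
      have hmem := memH2_I_mul
        (fun x => hasDerivAt_trial (hp x) (hq x) (hθ x) h₀ h₁)
        (fun x => hasDerivAt_trialDeriv (hp x) (hq x) (hθ x) (hpq x) h₀ h₁ h₂) cv₂
        (L := L) fun x hx => hvz x hx.le
      have h := hpos _ _ _ hmem
      have hq' : ∀ x, deriv (profile ℰ) x = q x := fun x => (hp x).deriv
      simp only [secondVariation, secondVariationDensity_I_mul, hq'] at h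
      rw [integral_const_mul] at h
      rw [intervalIntegral.integral_eq_integral_of_support_subset]
      · exact nonneg_of_mul_nonneg_right h two_pos
      · intro x hx
        by_contra hxL
        have hxL' : L ≤ |x| := by
          rw [le_abs]
          by_contra! hcon
          exact hxL ⟨by linarith [hcon.2], hcon.1.le⟩
        obtain ⟨e₀, e₁, e₂⟩ := hvz x hxL'
        exact hx (by simp [dens, imaginaryDensity, e₀, e₁, e₂])
    have hflux : ∫ x in -L..L, (dens x - ε * (2 * a ^ 3 * (2 + a - c)) * lead x
        - ε ^ 3 * rem x) = 0 := by
      have hB := intervalIntegral.integral_eq_sub_of_hasDerivAt (a := -L) (b := L)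
        (fun x _ => hasDerivAt_trialFlux (ε := ε) (c := c) (hp x) (hq x) (hθ x) (hpq x)
          (show ℰ ^ 2 = 1 - a ^ 2 by linarith) h₀ h₁ h₂)
        (((cdens.sub (continuous_const.mul clead)).sub
          (continuous_const.mul crem)).intervalIntegrable _ _)
      refine hB.trans ?_
      obtain ⟨e₀, e₁, e₂, -⟩ := hz _ (hfar L (le_abs_self L))
      obtain ⟨e₀', e₁', e₂', -⟩ := hz _ (hfar (-L) (by rw [abs_neg]; exact le_abs_self L))
      simp [trialFlux, e₀, e₁, e₂, e₀', e₁', e₂']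
    -- Substitution y = εθ(x); the image of [-L, L] covers the support of f₁.
    have hlead : ∫ x in -L..L, lead x = ∫ y, f₁ y ^ 2 := by
      have hcv := intervalIntegral.integral_comp_mul_deriv (a := -L) (b := L)
        (f := fun x => ε * θ x) (g := fun y => f₁ y ^ 2)
        (fun x _ => (hθ x).const_mul ε) (continuous_const.mul cτ).continuousOn (c₁.pow 2)
      refine hcv.trans (intervalIntegral.integral_eq_integral_of_support_subset ?_)
      intro y hy
      have hy2 : |y| ≤ 2 := by
        by_contra! hcon
        exact hy (by simp [(hz y hcon).2.1])
      rw [abs_le] at hy2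
      exact ⟨by linarith [hleft (-L) le_rfl], by linarith [hright L le_rfl]⟩
    have hrem : ∫ x in -L..L, rem x ≤ C * (2 * L) := by
      have h := intervalIntegral.norm_integral_le_of_norm_le_const (a := -L) (b := L)
        (f := rem) (C := C) fun x _ => hC ε _ _ _ ⟨hε0.le, hε.2⟩ (hp1 x) (hq1 x)
      rw [show |L - -L| = 2 * L by rw [sub_neg_eq_add, ← two_mul, abs_of_pos (by linarith)]] at h
      exact (le_abs_self _).trans h
    have c1 : Continuous fun x => dens x - ε * (2 * a ^ 3 * (2 + a - c)) * lead x := by fun_prop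
    have c2 : Continuous fun x => ε ^ 3 * rem x := by fun_prop
    have c3 : Continuous fun x => ε * (2 * a ^ 3 * (2 + a - c)) * lead x := by fun_prop
    rw [intervalIntegral.integral_sub (c1.intervalIntegrable _ _) (c2.intervalIntegrable _ _),
      intervalIntegral.integral_sub (cdens.intervalIntegrable _ _) (c3.intervalIntegrable _ _),
      intervalIntegral.integral_const_mul, intervalIntegral.integral_const_mul, hlead] at hflux
    have h3 : ε ^ 3 * (∫ x in -L..L, rem x) ≤ ε ^ 3 * (C * (2 * L)) :=
      mul_le_mul_of_nonneg_left hrem (by positivity)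
    -- Since L is of order 1/ε, the ε³ remainder costs only ε², one order below the leading term.
    have h4 : ε ^ 3 * (C * (2 * L)) = ε * (ε * (C * (6 / δ))) := by
      rw [hL]; field_simp; ring
    refine nonneg_of_mul_nonneg_right (a := ε) ?_ hε0
    linarith
  by_contra! hneg
  have hlim : Filter.Tendsto
      (fun ε : ℝ => 2 * (a ^ 3 * (2 + a - c)) * (∫ y, f₁ y ^ 2) + ε * (C * (6 / δ)))
      (nhdsWithin 0 (Set.Ioi 0))
      (nhds (2 * (a ^ 3 * (2 + a - c)) * (∫ y, f₁ y ^ 2) + 0 * (C * (6 / δ)))) :=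
    (Continuous.tendsto (by fun_prop) 0).mono_left nhdsWithin_le_nhds
  have hge := ge_of_tendsto hlim
    (Filter.mem_of_superset (Ioc_mem_nhdsGT (zero_lt_one' ℝ)) key)
  nlinarith [mul_neg_of_neg_of_pos hneg hJ]

end NLSWave

theorem proposition2 (ℰ : ℝ) (hℰ : ℰ ∈ Set.Ioo (0 : ℝ) 1) (c : ℝ) (hc : 1 ≤ c)
    (hpos : NLSWave.IsPositiveExceptSymmetries ℰ c) :
    c ∈ Set.Icc (NLSWave.cMinus ℰ) (NLSWave.cPlus ℰ) := by
  have h0 := hℰ.1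
  have h1 := hℰ.2
  have hs2 : √(1 - ℰ ^ 2) ^ 2 = 1 - ℰ ^ 2 := Real.sq_sqrt (by nlinarith)
  have hs : 0 < √(1 - ℰ ^ 2) := Real.sqrt_pos.2 (by nlinarith)
  rw [NLSWave.cMinus, NLSWave.cPlus, NLSWave.two_mul_modulus_div hℰ]
  set s := √(1 - ℰ ^ 2)
  have hs3 : 0 < s ^ 3 := by positivity
  -- From s² = (1 - ℰ)(1 + ℰ) > (1 - ℰ)². As u₀² ≤ 1 - ℰ, it keeps θ' = s(s - u₀²) positive when a =
  -- -s.
  have hlt : 1 - ℰ < s := by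
    refine lt_of_pow_lt_pow_left₀ 2 hs.le ?_
    rw [hs2]
    nlinarith
  constructor
  · have h := NLSWave.slope_nonneg (c := c) (a := -s) (δ := s * (s - (1 - ℰ))) hℰ
      (by rw [neg_sq, hs2]) (mul_pos hs (by linarith))
      (fun x => by nlinarith [NLSWave.profile_sq_le hℰ x]) hpos.nonneg
    have h' : 0 ≤ s ^ 3 * (c - (2 - s)) := by linarith
    linarith [nonneg_of_mul_nonneg_right h' hs3]
  · have h := NLSWave.slope_nonneg (c := c) (a := s) (δ := s * s) hℰ hs2 (mul_pos hs hs)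
      (fun x => by nlinarith [sq_nonneg (NLSWave.profile ℰ x)]) hpos.nonneg
    linarith [nonneg_of_mul_nonneg_right h hs3]
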